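/- **Theorem (Newton–Raphson iteration for least fixpoints).** Let $\mathbb C$ be a Cartesian closed differential category: a category with finite products that is Cartesian closed, whose hom-sets are commutative monoids such that $(f+g)\circ x=f\circ x+g\circ x$, $0\circ x=0$ and all projections are additive, with a differential combinator $\mathsf D$ sending $f:A\to B$ to $\mathsf D[f]:A\times A\to B$ satisfying the seven standard axioms CD.1–CD.7 of a Cartesian differential category (with the linear argument second), and whose evaluation maps are linear in their internal hom argument. Assume the following. * $\mathbb C$ is a differential fixpoint category: it has a parametrized fixpoint operator, sending $f:A\times X\to X$ to $\mathrm{fix}(f):A\to X$, with $f\circ\langle 1,\mathrm{fix}(f)\rangle=\mathrm{fix}(f)$, with $\mathrm{fix}(f)\circ g=\mathrm{fix}(f\circ(g\times 1_X))$, and with $\mathsf D[\mathrm{fix}(f)]=\pi_2\circ\mathrm{fix}(\mathsf T(f)\circ c)$, where $\mathsf T(f)=\langle f\circ\pi_1,\mathsf D[f]\rangle$ and $c$ interchanges the two middle factors. Write $\mathcal Y_X:=\mathrm{fix}(\mathrm{ev}_{X,X}):(X\Rightarrow X)\to X$, so that $\mathrm{fix}(f)=\mathcal Y_X\circ\lambda(f)$,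 and write $\mathcal Y(f):=\mathrm{fix}(f)$. * For the natural order ($g\le f$ iff $g+h=f$ for some $h$), $\mathbb C$ is $\omega$-cpo enriched, and addition preserves suprema of $\omega$-chains. * Each hom-set has a truncated subtraction $\ominus$, that is, $f\ominus g\le h\iff f\le g+h$. (It is not required that $(f\ominus g)\circ x=(f\circ x)\ominus(g\circ x)$.) * $\mathbb C$ is a Taylor category: the hom-sets have non-negative rational scalars, and $f(a+b)=\sum_n\frac1{n!}f^{(n)}(a)\cdot(b,\dots,b)$ for all $f:A\to B$ and all $a,b:\Gamma\to A$, the sum being the supremum of its partial sums. Here $f^{(n)}:A\times A^n\to B$ is the $n$-fold iterated partial derivative in the first factor. * $\mathcal Y_X=\bigvee_n\mathcal Y_{X,n}$, where $\mathcal Y_{X,0}=0$ and $\mathcal Y_{X,n+1}=\mathrm{ev}\circ\langle 1,\mathcal Y_{X,n}\rangle$. For $h:\Gamma\times X\to X$ let $h^*:\Gamma\times X\to X$ be $h^*(\gamma,b)=\mu x.\,(b+h(\gamma,x))$, where $\mu$ is the operator $\mathrm{fix}$. For $f:A\times X\to X$ and $z:A\to X$ let $(\mathsf D_zf)(a,b)=\mathsf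 D[f]\big((a,z(a)),(0,b)\big)$. The Newton approximants $\mathcal Z_n(f):A\to X$ of $f$ are defined by $\mathcal Z_0(f)=0$ and $$\mathcal Z_{n+1}(f)=z+(\mathsf D_zf)^*\circ\big\langle 1_A,\ (f\circ\langle1_A,z\rangle)\ominus z\big\rangle,\qquad z=\mathcal Z_n(f),$$ with $\ominus$ taken in $\mathbb C(A,X)$. The higher-order approximants are $\mathcal Z_{X,n}:=\mathcal Z_n(\mathrm{ev}_{X,X}):(X\Rightarrow X)\to X$. The Taylor pseudo-metric on $\mathbb C(A,B)$ is $d(f,g)=2^{-k}$, where $k$ is the least $n$ such that $f^{(n)}(0)\cdot(a,\dots,a)$ and $g^{(n)}(0)\cdot(a,\dots,a)$ differ as maps $A\to B$ in $a$, and $d(f,g)=0$ if there is no such $n$. 1. For every object $X$, $(\mathcal Z_{X,n})_n$ is an $\omega$-chain, $\mathcal Z_{X,n}\le\mathcal Y_X$ for all $n$, and $\bigvee_n\mathcal Z_{X,n}=\mathcal Y_X$. Likewise, for every $f:A\times X\to X$, $(\mathcal Z_n(f))_n$ is an $\omega$-chain, $\mathcal Z_n(f)\le\mathcal Y(f)$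 for all $n$, and $\bigvee_n\mathcal Z_n(f)=\mathcal Y(f)$. 2. Let $f:A\times X\to X$ satisfy $f(0,0)=0$, and suppose that the partial derivative of $f$ in its second argument is nilpotent in its linear argument: there is $p\ge1$ such that the $p$-fold iterate in $b$ of $b\mapsto\mathsf D[f]\big((a,x),(0,b)\big)$ is the zero map $(A\times X)\times X\to X$. Then for all $n$, $$d(\mathcal Z_{n+1}(f),\mathcal Y(f))\le d(\mathcal Z_n(f),\mathcal Y(f))^2,$$ and also $$d(\mathcal Z_{X,n+1}\circ\lambda(f),\ \mathcal Y_X\circ\lambda(f))\le d(\mathcal Z_{X,n}\circ\lambda(f),\ \mathcal Y_X\circ\lambda(f))^2.$$ -/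

import Mathlib

open CategoryTheory MonoidalCategory CartesianMonoidalCategory

universe v u

namespace NewtonFix

/-! Composition is written in diagrammatic order: `x ≫ f` is `f ∘ x`.  `A ⊗ B` is the chosen
binary product, `𝟙_ C` the terminal object, `lift f g` the pairing, `fst`, `snd` the projections. -/

/-- A Cartesian left additive category: every hom-set is a commutative monoid, pre-composition
preserves the additive structure, and the projections are additive maps. -/
class CartesianLeftAdditive (C : Type u) [Category.{v} C] [CartesianMonoidalCategory C] where
  homAddCommMonoid (A B : C) : AddCommMonoid (A ⟶ B)
  comp_add {A B D : C} (x : A ⟶ B) (f g : B ⟶ D) : x ≫ (f + g) = x ≫ f + x ≫ g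
  comp_zero {A B D : C} (x : A ⟶ B) : x ≫ (0 : B ⟶ D) = 0
  add_fst {Γ A B : C} (x y : Γ ⟶ A ⊗ B) : (x + y) ≫ fst A B = x ≫ fst A B + y ≫ fst A B
  zero_fst {Γ A B : C} : (0 : Γ ⟶ A ⊗ B) ≫ fst A B = 0
  add_snd {Γ A B : C} (x y : Γ ⟶ A ⊗ B) : (x + y) ≫ snd A B = x ≫ snd A B + y ≫ snd A B
  zero_snd {Γ A B : C} : (0 : Γ ⟶ A ⊗ B) ≫ snd A B = 0

attribute [reducible, instance] CartesianLeftAdditive.homAddCommMonoid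

/-- A Cartesian differential category: a Cartesian left additive category with a differential
combinator `D`, the linear argument being the second one. -/
class CartesianDifferential (C : Type u) [Category.{v} C] [CartesianMonoidalCategory C]
    [CartesianLeftAdditive C] where
  D {A B : C} (f : A ⟶ B) : A ⊗ A ⟶ B
  D_zero {A B : C} : D (0 : A ⟶ B) = 0
  D_add {A B : C} (f g : A ⟶ B) : D (f + g) = D f + D g
  lift_zero_D {Γ A B : C} (f : A ⟶ B) (x : Γ ⟶ A) : lift x 0 ≫ D f = 0
  lift_add_D {Γ A B : C} (f : A ⟶ B) (x y z : Γ ⟶ A) :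
    lift x (y + z) ≫ D f = lift x y ≫ D f + lift x z ≫ D f
  D_id {A : C} : D (𝟙 A) = snd A A
  D_fst {A B : C} : D (fst A B) = snd (A ⊗ B) (A ⊗ B) ≫ fst A B
  D_snd {A B : C} : D (snd A B) = snd (A ⊗ B) (A ⊗ B) ≫ snd A B
  D_lift {A B₁ B₂ : C} (f : A ⟶ B₁) (g : A ⟶ B₂) : D (lift f g) = lift (D f) (D g)
  D_comp {A B E : C} (f : A ⟶ B) (g : B ⟶ E) : D (f ≫ g) = lift (fst A A ≫ f) (D f) ≫ D g
  D_D_linear {Γ A B : C} (f : A ⟶ B) (x y z : Γ ⟶ A) :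
    lift (lift x y) (lift 0 z) ≫ D (D f) = lift x z ≫ D f
  D_D_symm {Γ A B : C} (f : A ⟶ B) (x y z : Γ ⟶ A) :
    lift (lift x y) (lift z 0) ≫ D (D f) = lift (lift x z) (lift y 0) ≫ D (D f)

open CartesianDifferential

section Closed

variable {C : Type u} [Category.{v} C] [CartesianMonoidalCategory C] [MonoidalClosed C]

/-- The evaluation map `(A ⇒ B) × A → B`. -/
def evalMap (A B : C) : (ihom A).obj B ⊗ A ⟶ B :=
  lift (snd ((ihom A).obj B) A) (fst ((ihom A).obj B) A) ≫ (ihom.ev A).app B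

/-- The currying `Γ → (A ⇒ B)` of `f : Γ × A → B`. -/
def lam {Γ A B : C} (f : Γ ⊗ A ⟶ B) : Γ ⟶ (ihom A).obj B :=
  MonoidalClosed.curry (lift (snd A Γ) (fst A Γ) ≫ f)

end Closed

/-- A Cartesian closed differential category: every evaluation map is linear in its internal hom
argument. -/
class CartesianClosedDifferential (C : Type u) [Category.{v} C] [CartesianMonoidalCategory C]
    [MonoidalClosed C] [CartesianLeftAdditive C] [CartesianDifferential C] : Prop where
  eval_linear {Γ A B : C} (f g : Γ ⟶ (ihom A).obj B) (a : Γ ⟶ A) :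
    lift (lift f a) (lift g 0) ≫ D (evalMap A B) = lift g a ≫ evalMap A B

section Tangent

variable {C : Type u} [Category.{v} C] [CartesianMonoidalCategory C] [CartesianLeftAdditive C]
  [CartesianDifferential C]

/-- The tangent bundle functor on maps, `T(f)(a, b) = (f(a), D[f](a, b))`. -/
def tangent {A B : C} (f : A ⟶ B) : A ⊗ A ⟶ B ⊗ B :=
  lift (fst A A ≫ f) (D f)

/-- The interchange `((a, b), (x, y)) ↦ ((a, x), (b, y))`. -/
def interchange (A X : C) : (A ⊗ A) ⊗ (X ⊗ X) ⟶ (A ⊗ X) ⊗ (A ⊗ X) :=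
  lift (lift (fst _ _ ≫ fst _ _) (snd _ _ ≫ fst _ _))
    (lift (fst _ _ ≫ snd _ _) (snd _ _ ≫ snd _ _))

end Tangent

/-- A Cartesian differential fixpoint category: a Cartesian differential category with a
parametrized fixpoint operator satisfying the differential-fixpoint rule. -/
class CartesianDifferentialFixpoint (C : Type u) [Category.{v} C] [CartesianMonoidalCategory C]
    [CartesianLeftAdditive C] [CartesianDifferential C] where
  fix {A X : C} (f : A ⊗ X ⟶ X) : A ⟶ X
  lift_fix {A X : C} (f : A ⊗ X ⟶ X) : lift (𝟙 A) (fix f) ≫ f = fix f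
  fix_natural {A B X : C} (g : A ⟶ B) (f : B ⊗ X ⟶ X) : g ≫ fix f = fix ((g ▷ X) ≫ f)
  D_fix {A X : C} (f : A ⊗ X ⟶ X) :
    D (fix f) = fix (interchange A X ≫ tangent f) ≫ snd X X

open CartesianDifferentialFixpoint

/-- Enrichment in `ω`-cpos for the natural order of addition, compatible with addition.
The bottom element is `0`, since `0 + h = h`. -/
class OmegaCpoEnriched (C : Type u) [Category.{v} C] [CartesianMonoidalCategory C]
    [CartesianLeftAdditive C] where
  homOmegaCpo (A B : C) : OmegaCompletePartialOrder (A ⟶ B)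
  le_iff_exists_add {A B : C} (g f : A ⟶ B) : g ≤ f ↔ ∃ h : A ⟶ B, g + h = f
  comp_continuous (A B E : C) :
    OmegaCompletePartialOrder.ωScottContinuous
      (fun p : (A ⟶ B) × (B ⟶ E) => p.1 ≫ p.2)
  add_continuous (A B : C) :
    OmegaCompletePartialOrder.ωScottContinuous
      (fun p : (A ⟶ B) × (A ⟶ B) => p.1 + p.2)

attribute [reducible, instance] OmegaCpoEnriched.homOmegaCpo

/-- Truncated subtraction on the hom-sets: `f ⊖ g ≤ h` if and only if `f ≤ g + h`. -/
class TruncatedSubtraction (C : Type u) [Category.{v} C] [CartesianMonoidalCategory C]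
    [CartesianLeftAdditive C] [OmegaCpoEnriched C] where
  tsub {A B : C} (f g : A ⟶ B) : A ⟶ B
  tsub_le_iff {A B : C} (f g h : A ⟶ B) : tsub f g ≤ h ↔ f ≤ g + h

open TruncatedSubtraction

section Derivatives

variable {C : Type u} [Category.{v} C] [CartesianMonoidalCategory C] [CartesianLeftAdditive C]
  [CartesianDifferential C]

/-- `A × Aⁿ`, bracketed to the left. -/
def powObj (A : C) : ℕ → C
  | 0 => A
  | n + 1 => powObj A n ⊗ A

/-- The map `Γ → A × Aⁿ`, `γ ↦ (a(γ), b(γ), …, b(γ))`. -/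
def diagTuple {Γ A : C} (a b : Γ ⟶ A) : (n : ℕ) → (Γ ⟶ powObj A n)
  | 0 => a
  | n + 1 => lift (diagTuple a b n) b

/-- The `n`-th derivative `f⁽ⁿ⁾ : A × Aⁿ → B`, obtained by iterating the partial derivative in the
first factor: `f⁽ⁿ⁺¹⁾((a, b₁, …, bₙ), c) = D[f⁽ⁿ⁾]((a, b₁, …, bₙ), (c, 0, …, 0))`. -/
def iterD {A B : C} (f : A ⟶ B) : (n : ℕ) → (powObj A n ⟶ B)
  | 0 => f
  | n + 1 => (powObj A n ◁ diagTuple (𝟙 A) 0 n) ≫ D (iterD f n)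

/-- The partial derivative of `f : A × X → B` in its second argument,
`((a, x), b) ↦ D[f]((a, x), (0, b))`. -/
def partialD₂ {A X B : C} (f : A ⊗ X ⟶ B) : (A ⊗ X) ⊗ X ⟶ B :=
  lift (fst (A ⊗ X) X) (lift 0 (snd (A ⊗ X) X)) ≫ D f

/-- For `f : A × X → B` and `z : A → X`, the map `(a, b) ↦ (∂f(a, v)/∂v)(z(a)) · b`. -/
def partialDAt {A X B : C} (f : A ⊗ X ⟶ B) (z : A ⟶ X) : A ⊗ X ⟶ B :=
  (lift (𝟙 A) z ▷ X) ≫ partialD₂ f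

/-- The `p`-fold iterate `(γ, b) ↦ h(γ, h(γ, … h(γ, b)))` of `h` in its second argument. -/
def iterSnd {Γ X : C} (h : Γ ⊗ X ⟶ X) : ℕ → (Γ ⊗ X ⟶ X)
  | 0 => snd Γ X
  | p + 1 => lift (fst Γ X) (iterSnd h p) ≫ h

/-- The partial derivative of `f` in its second argument is nilpotent in its linear argument. -/
def NilpotentPartial {A X : C} (f : A ⊗ X ⟶ X) : Prop :=
  ∃ p : ℕ, 1 ≤ p ∧ iterSnd (partialD₂ f) p = 0

/-- The `n`-th Taylor monomial `a ↦ f⁽ⁿ⁾(0, a, …, a)`. -/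
def taylorMonomial {A B : C} (n : ℕ) (f : A ⟶ B) : A ⟶ B :=
  diagTuple (0 : A ⟶ A) (𝟙 A) n ≫ iterD f n

open Classical in
/-- The Taylor pseudo-metric: `2⁻ᵏ` for the least `k` at which the Taylor monomials of `f` and `g`
differ, and `0` if there is none. -/
noncomputable def taylorDist {A B : C} (f g : A ⟶ B) : ℝ :=
  if h : ∃ n, taylorMonomial n f ≠ taylorMonomial n g then (2 : ℝ)⁻¹ ^ Nat.find h else 0

end Derivatives

/-- A Taylor category: the hom-sets have non-negative rational scalars (such scalars are unique,
and their existence says that multiplication by each positive integer is invertible), and for all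
`f : A → B` and all generalized elements `a`, `b` of `A`,
`f(a + b) = ∑ₙ (1/n!) f⁽ⁿ⁾(a, b, …, b)`, the sum being the supremum of its partial sums. -/
class TaylorCategory (C : Type u) [Category.{v} C] [CartesianMonoidalCategory C]
    [CartesianLeftAdditive C] [CartesianDifferential C] [OmegaCpoEnriched C] where
  homModule (A B : C) : Module ℚ≥0 (A ⟶ B)
  taylor {Γ A B : C} (f : A ⟶ B) (a b : Γ ⟶ A) :
    IsLUB (Set.range fun N : ℕ => ∑ n ∈ Finset.range N,
      ((n.factorial : ℚ≥0)⁻¹) • (diagTuple a b n ≫ iterD f n)) ((a + b) ≫ f)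

attribute [reducible, instance] TaylorCategory.homModule

section Combinator

variable {C : Type u} [Category.{v} C] [CartesianMonoidalCategory C] [MonoidalClosed C]
  [CartesianLeftAdditive C] [CartesianDifferential C] [CartesianDifferentialFixpoint C]

/-- The fixpoint combinator `𝒴 : (X ⇒ X) → X` of the parametrized fixpoint operator. -/
def fixComb (X : C) : (ihom X).obj X ⟶ X :=
  fix (evalMap X X)

/-- The Kleene approximants `𝒴₀ = 0`, `𝒴ₙ₊₁ = evalMap ∘ ⟨1, 𝒴ₙ⟩`. -/
def kleeneComb (X : C) : ℕ → ((ihom X).obj X ⟶ X)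
  | 0 => 0
  | n + 1 => lift (𝟙 _) (kleeneComb X n) ≫ evalMap X X

end Combinator

/-- The fixpoint combinators are obtained by Kleene iteration. -/
class KleeneFixpoint (C : Type u) [Category.{v} C] [CartesianMonoidalCategory C]
    [MonoidalClosed C] [CartesianLeftAdditive C] [CartesianDifferential C]
    [CartesianDifferentialFixpoint C] [OmegaCpoEnriched C] : Prop where
  isLUB_kleeneComb (X : C) : IsLUB (Set.range (kleeneComb X)) (fixComb X)

section Newton

variable {C : Type u} [Category.{v} C] [CartesianMonoidalCategory C]
  [CartesianLeftAdditive C] [CartesianDifferential C] [CartesianDifferentialFixpoint C]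

/-- The repetition operator in context, `h*(γ, b) = μ x. (b + h(γ, x))`. -/
def repStar {Γ X : C} (h : Γ ⊗ X ⟶ X) : Γ ⊗ X ⟶ X :=
  fix (fst (Γ ⊗ X) X ≫ snd Γ X + (fst Γ X ▷ X) ≫ h)

variable [OmegaCpoEnriched C] [TruncatedSubtraction C]

/-- The Newton step at `z : A → X`:
`a ↦ z(a) + (∂f(a, v)/∂v (z(a)))* · (f(a, z(a)) ⊖ z(a))`, with `⊖` taken in the hom-set `A ⟶ X`. -/
def newtonStep {A X : C} (f : A ⊗ X ⟶ X) (z : A ⟶ X) : A ⟶ X :=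
  z + lift (𝟙 A) (tsub (lift (𝟙 A) z ≫ f) z) ≫ repStar (partialDAt f z)

/-- The Newton approximants `𝒵ₙ(f) : A → X` of `f : A × X → X`. -/
def newton {A X : C} (f : A ⊗ X ⟶ X) : ℕ → (A ⟶ X)
  | 0 => 0
  | n + 1 => newtonStep f (newton f n)

/-- The Newton approximants `𝒵ₙ : (X ⇒ X) → X` as higher order maps: those of the generic map
`evalMap : (X ⇒ X) × X → X`. -/
def newtonComb [MonoidalClosed C] (X : C) : ℕ → ((ihom X).obj X ⟶ X) :=
  newton (evalMap X X)

end Newton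

end NewtonFix

namespace NewtonFix

open CartesianDifferential CartesianDifferentialFixpoint TruncatedSubtraction
open OmegaCompletePartialOrder

set_option linter.unusedSectionVars false

/-! ### Additive structure on hom-sets -/

section Additive

variable {C : Type u} [Category.{v} C] [CartesianMonoidalCategory C] [CartesianLeftAdditive C]

/-! Convergence rests on the first two Taylor terms: `f(z) + D_z f · w ≤ f(z + w)`. If `z ≤ f(z)`,
then `d = f(z) ⊖ z` is an exact difference, and the correction `w = d + D_z f · w` gives `z + w =
f(z) + D_z f · w`. Hence `f(z) ≤ z + w ≤ f(z + w)`: the invariant persists and a Newton step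
dominates a Kleene step. Comparison with the Kleene iterates that define `w` gives `z + w ≤ fix f`.

For the quadratic rate, put `u = fix f ⊖ z`. If `z` and `fix f` agree below degree `k`, then `u` has
no terms below degree `k`, and the second-order Taylor remainder of `f(z + u)` has none below degree
`2k`. So `u ≤ d + D_z f · u` in those degrees; iterating, `u ≤ w + (D_z f)^p u`, and nilpotency
leaves `u ≤ w` (`taylorHom_newton_correction`).

Two facts need work: the vanishing of the remainder (`jet_secondDeriv_eq_zero`), and the
compatibility of `⊖` with inequalities in a single degree (`taylorHom_tsub_le`). The latter needs
maps with prescribed Taylor monomials, hence continuity of `D` and the computation of monomials of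
monomials. -/

theorem comp_add {A B E : C} (x : A ⟶ B) (f g : B ⟶ E) : x ≫ (f + g) = x ≫ f + x ≫ g :=
  CartesianLeftAdditive.comp_add x f g

@[simp]
theorem comp_zero {A B E : C} (x : A ⟶ B) : x ≫ (0 : B ⟶ E) = 0 :=
  CartesianLeftAdditive.comp_zero x

theorem lift_add_lift {Γ A B : C} (a c : Γ ⟶ A) (b d : Γ ⟶ B) :
    lift a b + lift c d = lift (a + c) (b + d) := by
  apply CartesianMonoidalCategory.hom_ext
  · simp [CartesianLeftAdditive.add_fst]
  · simp [CartesianLeftAdditive.add_snd]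

theorem lift_zero_zero {Γ A B : C} : lift (0 : Γ ⟶ A) (0 : Γ ⟶ B) = 0 := by
  apply CartesianMonoidalCategory.hom_ext
  · simp [CartesianLeftAdditive.zero_fst]
  · simp [CartesianLeftAdditive.zero_snd]

/-- Precomposition as a homomorphism of monoids. -/
def precompHom {A B : C} (x : A ⟶ B) (E : C) : (B ⟶ E) →+ (A ⟶ E) where
  toFun f := x ≫ f
  map_zero' := comp_zero x
  map_add' := comp_add x

end Additive

/-! ### The natural order and suprema of chains -/

section Order

variable {C : Type u} [Category.{v} C] [CartesianMonoidalCategory C] [CartesianLeftAdditive C]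
  [OmegaCpoEnriched C]

instance (A B : C) : IsOrderedAddMonoid (A ⟶ B) where
  add_le_add_left a b h c := by
    obtain ⟨d, rfl⟩ := (OmegaCpoEnriched.le_iff_exists_add a b).1 h
    exact (OmegaCpoEnriched.le_iff_exists_add _ _).2 ⟨d, by abel⟩

instance (A B : C) : CanonicallyOrderedAdd (A ⟶ B) where
  exists_add_of_le {a b} h := by
    obtain ⟨d, rfl⟩ := (OmegaCpoEnriched.le_iff_exists_add a b).1 h
    exact ⟨d, rfl⟩
  le_add_self a b := (OmegaCpoEnriched.le_iff_exists_add _ _).2 ⟨b, add_comm _ _⟩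
  le_self_add a b := (OmegaCpoEnriched.le_iff_exists_add _ _).2 ⟨b, rfl⟩

theorem lift_le_lift {Γ A B : C} {a c : Γ ⟶ A} {b d : Γ ⟶ B} (h : a ≤ c) (k : b ≤ d) :
    lift a b ≤ lift c d := by
  obtain ⟨x, rfl⟩ := exists_add_of_le h
  obtain ⟨y, rfl⟩ := exists_add_of_le k
  rw [← lift_add_lift]
  exact le_self_add

theorem comp_le_comp {A B E : C} {x y : A ⟶ B} {f g : B ⟶ E} (h : x ≤ y) (k : f ≤ g) :
    x ≫ f ≤ y ≫ g :=
  (OmegaCpoEnriched.comp_continuous A B E).monotone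
    (show ((x, f) : (A ⟶ B) × (B ⟶ E)) ≤ (y, g) from ⟨h, k⟩)

theorem monotone_of_additive {A B A' B' : C} (F : (A ⟶ B) → (A' ⟶ B'))
    (hF : ∀ f g, F (f + g) = F f + F g) : Monotone F := by
  intro f g h
  obtain ⟨d, rfl⟩ := exists_add_of_le h
  rw [hF]
  exact le_self_add

/-- A map between hom-sets preserves least upper bounds of increasing sequences. -/
def PreservesSup {A B A' B' : C} (F : (A ⟶ B) → (A' ⟶ B')) : Prop :=
  ∀ (c : ℕ → (A ⟶ B)) (s : A ⟶ B), Monotone c → IsLUB (Set.range c) s →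
    IsLUB (Set.range fun n => F (c n)) (F s)

theorem PreservesSup.comp {A B A' B' A'' B'' : C} {F : (A ⟶ B) → (A' ⟶ B')}
    {G : (A' ⟶ B') → (A'' ⟶ B'')} (hG : PreservesSup G) (hF : PreservesSup F)
    (hm : Monotone F) : PreservesSup fun f => G (F f) :=
  fun c s hc hs => hG _ _ (hm.comp hc) (hF c s hc hs)

theorem preservesSup_of_scott {A B A' B' : C} {F : (A ⟶ B) → (A' ⟶ B')}
    (hF : ωScottContinuous F) : PreservesSup F := by
  intro c s hc hs
  have h1 : s = ωSup ⟨c, hc⟩ := hs.unique (isLUB_range_ωSup ⟨c, hc⟩)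
  rw [h1]
  exact hF.isLUB (c := ⟨c, hc⟩)

theorem preservesSup_precomp {A B E : C} (x : A ⟶ B) :
    PreservesSup fun f : B ⟶ E => x ≫ f :=
  preservesSup_of_scott
    ((OmegaCpoEnriched.comp_continuous A B E).comp
      (Prod.ωScottContinuous.prodMk ωScottContinuous.const ωScottContinuous.id))

theorem preservesSup_postcomp {A B E : C} (f : B ⟶ E) :
    PreservesSup fun x : A ⟶ B => x ≫ f :=
  preservesSup_of_scott
    ((OmegaCpoEnriched.comp_continuous A B E).comp
      (Prod.ωScottContinuous.prodMk ωScottContinuous.id ωScottContinuous.const))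

theorem preservesSup_add {A B : C} (g : A ⟶ B) : PreservesSup fun f : A ⟶ B => g + f :=
  preservesSup_of_scott
    ((OmegaCpoEnriched.add_continuous A B).comp
      (Prod.ωScottContinuous.prodMk ωScottContinuous.const ωScottContinuous.id))

theorem add_tsub_of_le [TruncatedSubtraction C] {A B : C} {f g : A ⟶ B} (h : g ≤ f) :
    g + tsub f g = f := by
  apply le_antisymm
  · obtain ⟨d, rfl⟩ := exists_add_of_le h
    exact add_le_add_right ((tsub_le_iff _ _ _).2 le_rfl) _
  · exact (tsub_le_iff _ _ _).1 le_rfl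

end Order

/-! ### Currying as an order isomorphism -/

section Closed

variable {C : Type u} [Category.{v} C] [CartesianMonoidalCategory C] [MonoidalClosed C]

theorem lam_whiskerRight_evalMap {Γ A B : C} (f : Γ ⊗ A ⟶ B) :
    (lam f ▷ A) ≫ evalMap A B = f := by
  have h : (A ◁ lam f) ≫ (ihom.ev A).app B = lift (snd A Γ) (fst A Γ) ≫ f := by
    unfold lam
    rw [← MonoidalClosed.uncurry_eq, MonoidalClosed.uncurry_curry]
  have h' : (lam f ▷ A) ≫ lift (snd ((ihom A).obj B) A) (fst ((ihom A).obj B) A)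
      = lift (snd Γ A) (fst Γ A) ≫ (A ◁ lam f) := by
    apply CartesianMonoidalCategory.hom_ext <;> simp
  rw [evalMap, ← Category.assoc, h', Category.assoc, h, ← Category.assoc]
  have : lift (snd Γ A) (fst Γ A) ≫ lift (snd A Γ) (fst A Γ) = 𝟙 _ := by
    apply CartesianMonoidalCategory.hom_ext <;> simp
  rw [this, Category.id_comp]

theorem lam_eq_iff {Γ A B : C} (f : Γ ⊗ A ⟶ B) (g : Γ ⟶ (ihom A).obj B) :
    lam f = g ↔ f = (g ▷ A) ≫ evalMap A B := by
  constructor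
  · rintro rfl
    exact (lam_whiskerRight_evalMap f).symm
  · rintro rfl
    unfold lam
    rw [MonoidalClosed.curry_eq_iff, MonoidalClosed.uncurry_eq, evalMap]
    simp only [← Category.assoc]
    congr 1
    apply CartesianMonoidalCategory.hom_ext <;> simp

theorem lift_lam_evalMap {Δ Γ A B : C} (f : Γ ⊗ A ⟶ B) (x : Δ ⟶ Γ) (a : Δ ⟶ A) :
    lift (x ≫ lam f) a ≫ evalMap A B = lift x a ≫ f := by
  conv_rhs => rw [← lam_whiskerRight_evalMap f, ← Category.assoc, lift_whiskerRight]

variable [CartesianLeftAdditive C] [CartesianDifferential C] [CartesianClosedDifferential C]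

/-- By linearity, evaluation is its own derivative in the function argument, and derivatives are
additive in the direction. -/
theorem lift_add_evalMap {Γ A B : C} (f g : Γ ⟶ (ihom A).obj B) (a : Γ ⟶ A) :
    lift (f + g) a ≫ evalMap A B = lift f a ≫ evalMap A B + lift g a ≫ evalMap A B := by
  rw [← CartesianClosedDifferential.eval_linear 0 (f + g) a,
    ← CartesianClosedDifferential.eval_linear 0 f a,
    ← CartesianClosedDifferential.eval_linear 0 g a, ← lift_add_D, lift_add_lift, add_zero]

theorem lam_add {Γ A B : C} (f g : Γ ⊗ A ⟶ B) : lam (f + g) = lam f + lam g := by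
  rw [lam_eq_iff]
  have h : (lam f + lam g) ▷ A = lift (fst Γ A ≫ lam f + fst Γ A ≫ lam g) (snd Γ A) := by
    apply CartesianMonoidalCategory.hom_ext <;> simp [comp_add]
  rw [h, lift_add_evalMap, lift_lam_evalMap, lift_lam_evalMap]
  simp

theorem evalMap_add {Γ A B : C} (f g : Γ ⟶ (ihom A).obj B) :
    ((f + g) ▷ A) ≫ evalMap A B = (f ▷ A) ≫ evalMap A B + (g ▷ A) ≫ evalMap A B := by
  have h (k : Γ ⟶ (ihom A).obj B) : k ▷ A = lift (fst Γ A ≫ k) (snd Γ A) := by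
    apply CartesianMonoidalCategory.hom_ext <;> simp
  rw [h, h, h, comp_add, lift_add_evalMap]

variable [OmegaCpoEnriched C]

/-- Currying and uncurrying are both additive, hence both monotone for the natural order. -/
theorem lam_le_iff {Γ A B : C} (f : Γ ⊗ A ⟶ B) (g : Γ ⟶ (ihom A).obj B) :
    lam f ≤ g ↔ f ≤ (g ▷ A) ≫ evalMap A B := by
  constructor
  · intro h
    have := monotone_of_additive (fun k : Γ ⟶ (ihom A).obj B => (k ▷ A) ≫ evalMap A B)
      evalMap_add h
    simpa only [lam_whiskerRight_evalMap] using this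
  · intro h
    have := monotone_of_additive (fun k : Γ ⊗ A ⟶ B => lam k) lam_add h
    exact this.trans_eq ((lam_eq_iff ((g ▷ A) ≫ evalMap A B) g).2 rfl)

theorem preservesSup_lam {Γ A B : C} : PreservesSup fun f : Γ ⊗ A ⟶ B => lam f := by
  intro c s _ hs
  constructor
  · rintro _ ⟨n, rfl⟩
    exact monotone_of_additive _ lam_add (hs.1 ⟨n, rfl⟩)
  · intro g hg
    refine (lam_le_iff s g).2 (hs.2 ?_)
    rintro _ ⟨n, rfl⟩
    exact (lam_le_iff (c n) g).1 (hg ⟨n, rfl⟩)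

end Closed

/-! ### Partial derivatives under substitution -/

section Differential

variable {C : Type u} [Category.{v} C] [CartesianMonoidalCategory C] [CartesianLeftAdditive C]
  [CartesianDifferential C]

theorem lift_partialDAt {Γ A X B : C} (f : A ⊗ X ⟶ B) (z : A ⟶ X) (a : Γ ⟶ A) (b : Γ ⟶ X) :
    lift a b ≫ partialDAt f z = lift (lift a (a ≫ z)) (lift 0 b) ≫ D f := by
  simp only [partialDAt, partialD₂, ← Category.assoc]
  congr 1
  simp only [comp_lift, comp_zero, lift_fst, lift_snd, lift_whiskerRight,
    Category.comp_id]

theorem lift_add_partialDAt {Γ A X B : C} (f : A ⊗ X ⟶ B) (z : A ⟶ X) (a : Γ ⟶ A)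
    (b c : Γ ⟶ X) :
    lift a (b + c) ≫ partialDAt f z = lift a b ≫ partialDAt f z + lift a c ≫ partialDAt f z := by
  have h : lift (0 : Γ ⟶ A) (b + c) = lift 0 b + lift 0 c := by rw [lift_add_lift, add_zero]
  rw [lift_partialDAt, h, lift_add_D, ← lift_partialDAt, ← lift_partialDAt]

theorem D_whiskerRight_comp {Γ A A' X B : C} (g : A ⟶ A') (f : A' ⊗ X ⟶ B)
    (a : Γ ⟶ A) (x b : Γ ⟶ X) :
    lift (lift a x) (lift 0 b) ≫ D ((g ▷ X) ≫ f) =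
      lift (lift (a ≫ g) x) (lift 0 b) ≫ D f := by
  have h : g ▷ X = lift (fst A X ≫ g) (snd A X) := by
    apply CartesianMonoidalCategory.hom_ext <;> simp
  rw [D_comp, ← Category.assoc, comp_lift, ← Category.assoc (lift _ _) (fst _ _), lift_fst,
    lift_whiskerRight, h, D_lift, D_comp, D_fst, D_snd]
  congr 2
  simp only [comp_lift, comp_lift_assoc, lift_fst_assoc, lift_snd_assoc, lift_fst, lift_snd,
    lift_zero_D]

theorem whiskerRight_partialDAt {A A' X B : C} (g : A ⟶ A') (f : A' ⊗ X ⟶ B) (z : A' ⟶ X) :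
    (g ▷ X) ≫ partialDAt f z = partialDAt ((g ▷ X) ≫ f) (g ≫ z) := by
  have h : g ▷ X = lift (fst A X ≫ g) (snd A X) := by
    apply CartesianMonoidalCategory.hom_ext <;> simp
  have h' : lift (fst A X) (snd A X) ≫ partialDAt ((g ▷ X) ≫ f) (g ≫ z) =
      (g ▷ X) ≫ partialDAt f z := by
    rw [lift_partialDAt, D_whiskerRight_comp, h, lift_partialDAt, Category.assoc]
  rw [← h']
  simp

theorem whiskerRight_iterSnd {Γ Δ X : C} (g : Γ ⟶ Δ) (h : Δ ⊗ X ⟶ X) (p : ℕ) :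
    (g ▷ X) ≫ iterSnd h p = iterSnd ((g ▷ X) ≫ h) p := by
  induction p with
  | zero => simp [iterSnd]
  | succ p ih =>
    simp only [iterSnd]
    rw [← ih, ← Category.assoc, ← Category.assoc, lift_whiskerRight, comp_lift,
      whiskerRight_fst]

theorem lift_iterSnd_succ {Γ X : C} (h : Γ ⊗ X ⟶ X) (u : Γ ⟶ X) (p : ℕ) :
    lift (𝟙 Γ) u ≫ iterSnd h (p + 1) = lift (𝟙 Γ) (lift (𝟙 Γ) u ≫ iterSnd h p) ≫ h := by
  rw [iterSnd, ← Category.assoc, comp_lift, lift_fst]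

theorem exists_iterSnd_partialDAt_eq_zero {A X : C} {f : A ⊗ X ⟶ X} (hf : NilpotentPartial f)
    (z : A ⟶ X) : ∃ p, iterSnd (partialDAt f z) p = 0 := by
  obtain ⟨p, -, hp⟩ := hf
  exact ⟨p, by rw [partialDAt, ← whiskerRight_iterSnd, hp, comp_zero]⟩

end Differential

/-! ### Kleene and Newton approximants; convergence from below -/

section Fix

variable {C : Type u} [Category.{v} C] [CartesianMonoidalCategory C] [CartesianLeftAdditive C]
  [CartesianDifferential C] [CartesianDifferentialFixpoint C]

/-- The Kleene approximants of `f`. -/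
def kleene {A X : C} (f : A ⊗ X ⟶ X) : ℕ → (A ⟶ X)
  | 0 => 0
  | n + 1 => lift (𝟙 A) (kleene f n) ≫ f

/-- The body `(γ, x) ↦ d(γ) + h(γ, x)` of the fixpoint `h* ∘ ⟨1, d⟩`. -/
def starBody {Γ X : C} (h : Γ ⊗ X ⟶ X) (d : Γ ⟶ X) : Γ ⊗ X ⟶ X :=
  fst Γ X ≫ d + h

theorem lift_starBody {Γ X : C} (h : Γ ⊗ X ⟶ X) (d x : Γ ⟶ X) :
    lift (𝟙 Γ) x ≫ starBody h d = d + lift (𝟙 Γ) x ≫ h := by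
  rw [starBody, comp_add, lift_fst_assoc, Category.id_comp]

theorem lift_repStar {Γ X : C} (h : Γ ⊗ X ⟶ X) (d : Γ ⟶ X) :
    lift (𝟙 Γ) d ≫ repStar h = fix (starBody h d) := by
  rw [repStar, fix_natural, comp_add, starBody]
  congr 2
  · simp
  · rw [← Category.assoc, ← comp_whiskerRight, lift_fst, id_whiskerRight, Category.id_comp]

/-- Here `d` is arbitrary: precomposition need not commute with `⊖`, but it does commute with the
rest of the Newton correction. -/
theorem comp_lift_repStar_partialDAt {A A' X : C} (g : A ⟶ A') (f : A' ⊗ X ⟶ X)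
    (z d : A' ⟶ X) :
    g ≫ lift (𝟙 A') d ≫ repStar (partialDAt f z) =
      lift (𝟙 A) (g ≫ d) ≫ repStar (partialDAt ((g ▷ X) ≫ f) (g ≫ z)) := by
  rw [lift_repStar, lift_repStar, fix_natural, starBody, starBody, comp_add,
    whiskerRight_partialDAt, whiskerRight_fst_assoc]

variable [MonoidalClosed C]

theorem lam_fixComb {A X : C} (f : A ⊗ X ⟶ X) : lam f ≫ fixComb X = fix f := by
  rw [fixComb, fix_natural, lam_whiskerRight_evalMap]

theorem lam_kleeneComb {A X : C} (f : A ⊗ X ⟶ X) (n : ℕ) :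
    lam f ≫ kleeneComb X n = kleene f n := by
  induction n with
  | zero => exact comp_zero _
  | succ n ih =>
    rw [kleeneComb, ← Category.assoc, comp_lift, ih, kleene, Category.comp_id,
      ← lift_lam_evalMap f, Category.id_comp]

variable [OmegaCpoEnriched C]

theorem kleene_monotone {A X : C} (f : A ⊗ X ⟶ X) : Monotone (kleene f) := by
  refine monotone_nat_of_le_succ fun n => ?_
  induction n with
  | zero => exact zero_le
  | succ n ih => exact comp_le_comp (lift_le_lift le_rfl ih) le_rfl

theorem kleeneComb_monotone (X : C) : Monotone (kleeneComb X) := by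
  refine monotone_nat_of_le_succ fun n => ?_
  induction n with
  | zero => exact zero_le
  | succ n ih => exact comp_le_comp (lift_le_lift le_rfl ih) le_rfl

theorem isLUB_kleene [KleeneFixpoint C] {A X : C} (f : A ⊗ X ⟶ X) :
    IsLUB (Set.range (kleene f)) (fix f) := by
  have := preservesSup_precomp (lam f) _ _ (kleeneComb_monotone X)
    (KleeneFixpoint.isLUB_kleeneComb X)
  simpa only [lam_fixComb, lam_kleeneComb] using this

variable [TaylorCategory C]

theorem taylor_first_order {Γ A B : C} (f : A ⟶ B) (a b : Γ ⟶ A) :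
    a ≫ f + lift a b ≫ D f ≤ (a + b) ≫ f := by
  -- The partial sum with two terms lies below the supremum.
  have h := (TaylorCategory.taylor f a b).1 ⟨2, rfl⟩
  dsimp only at h
  rw [Finset.sum_range_succ, Finset.sum_range_one] at h
  simp only [Nat.factorial, Nat.cast_one, inv_one, one_smul, mul_one] at h
  have h' : a ≫ f + lift a b ≫ (A ◁ 𝟙 A) ≫ D f ≤ (a + b) ≫ f := h
  rwa [whiskerLeft_id, Category.id_comp] at h'

theorem taylor_partialDAt {A X B : C} (f : A ⊗ X ⟶ B) (z w : A ⟶ X) :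
    lift (𝟙 A) z ≫ f + lift (𝟙 A) w ≫ partialDAt f z ≤ lift (𝟙 A) (z + w) ≫ f := by
  have h := taylor_first_order f (lift (𝟙 A) z) (lift 0 w)
  rwa [lift_add_lift, add_zero, ← Category.id_comp z, ← lift_partialDAt, Category.id_comp] at h

variable {A X : C} (f : A ⊗ X ⟶ X) {z d : A ⟶ X}

/-- Unfold the fixpoint once. Only `z + d = f(z)` is assumed of `d`, so that the same argument
covers `newton f` and `lam f ≫ newtonComb X n`, where `d` need not be a truncated difference. -/
theorem newton_correction (h : z + d = lift (𝟙 A) z ≫ f) :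
    z + lift (𝟙 A) d ≫ repStar (partialDAt f z) =
      lift (𝟙 A) z ≫ f +
        lift (𝟙 A) (lift (𝟙 A) d ≫ repStar (partialDAt f z)) ≫ partialDAt f z := by
  rw [lift_repStar, ← h, add_assoc, ← lift_starBody, lift_fix]

theorem newton_correction_le (h : z + d = lift (𝟙 A) z ≫ f) :
    z + lift (𝟙 A) d ≫ repStar (partialDAt f z) ≤
      lift (𝟙 A) (z + lift (𝟙 A) d ≫ repStar (partialDAt f z)) ≫ f :=
  (newton_correction f h).trans_le (taylor_partialDAt f _ _)

theorem apply_le_newton_correction (h : z + d = lift (𝟙 A) z ≫ f) :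
    lift (𝟙 A) z ≫ f ≤ z + lift (𝟙 A) d ≫ repStar (partialDAt f z) :=
  le_self_add.trans_eq (newton_correction f h).symm

/-- Induction on the Kleene iterates `xₙ` of the correction: `z + xₙ₊₁ = f(z) + D_z f · xₙ ≤ f(z +
xₙ) ≤ f(fix f) = fix f`. -/
theorem newton_correction_le_fix [KleeneFixpoint C] (h : z + d = lift (𝟙 A) z ≫ f)
    (hz : z ≤ fix f) : z + lift (𝟙 A) d ≫ repStar (partialDAt f z) ≤ fix f := by
  rw [lift_repStar]
  refine (preservesSup_add z _ _ (kleene_monotone _) (isLUB_kleene _)).2 ?_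
  rintro _ ⟨n, rfl⟩
  induction n with
  | zero => simpa [kleene] using hz
  | succ n ih =>
    dsimp only [kleene]
    rw [lift_starBody, ← add_assoc, h, ← lift_fix f]
    exact (taylor_partialDAt f _ _).trans (comp_le_comp (lift_le_lift le_rfl ih) le_rfl)

variable [TruncatedSubtraction C]

/-- The invariant that makes every truncated subtraction in the iteration exact. -/
theorem newton_le_apply (n : ℕ) : newton f n ≤ lift (𝟙 A) (newton f n) ≫ f := by
  induction n with
  | zero => exact zero_le
  | succ n ih => exact newton_correction_le f (add_tsub_of_le ih)

theorem newton_succ (n : ℕ) : newton f (n + 1) = newton f n +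
    lift (𝟙 A) (tsub (lift (𝟙 A) (newton f n) ≫ f) (newton f n)) ≫
      repStar (partialDAt f (newton f n)) := rfl

theorem newton_monotone : Monotone (newton f) :=
  monotone_nat_of_le_succ fun _ => le_self_add

theorem newton_le_fix [KleeneFixpoint C] (n : ℕ) : newton f n ≤ fix f := by
  induction n with
  | zero => exact zero_le
  | succ n ih => exact newton_correction_le_fix f (add_tsub_of_le (newton_le_apply f n)) ih

theorem kleene_le_newton (n : ℕ) : kleene f n ≤ newton f n := by
  induction n with
  | zero => exact le_rfl
  | succ n ih =>
    exact (comp_le_comp (lift_le_lift le_rfl ih) le_rfl).trans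
      (apply_le_newton_correction f (add_tsub_of_le (newton_le_apply f n)))

theorem isLUB_newton [KleeneFixpoint C] : IsLUB (Set.range (newton f)) (fix f) := by
  constructor
  · rintro _ ⟨n, rfl⟩
    exact newton_le_fix f n
  · intro g hg
    refine (isLUB_kleene f).2 ?_
    rintro _ ⟨n, rfl⟩
    exact (kleene_le_newton f n).trans (hg ⟨n, rfl⟩)

theorem lam_newtonComb_succ (n : ℕ) : lam f ≫ newtonComb X (n + 1) =
    lam f ≫ newtonComb X n + lift (𝟙 A) (lam f ≫
      tsub (lift (𝟙 _) (newtonComb X n) ≫ evalMap X X) (newtonComb X n)) ≫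
        repStar (partialDAt f (lam f ≫ newtonComb X n)) := by
  rw [newtonComb, newton_succ, comp_add, comp_lift_repStar_partialDAt, lam_whiskerRight_evalMap]

/-- The difference is exact for the generic map, and precomposition preserves sums, so exactness
survives substitution even where `⊖` itself does not. -/
theorem lam_newtonComb_add_tsub (n : ℕ) : lam f ≫ newtonComb X n + lam f ≫
      tsub (lift (𝟙 _) (newtonComb X n) ≫ evalMap X X) (newtonComb X n) =
    lift (𝟙 A) (lam f ≫ newtonComb X n) ≫ f := by
  rw [← comp_add, newtonComb, add_tsub_of_le (newton_le_apply (evalMap X X) n),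
    ← lift_lam_evalMap f, ← Category.assoc, comp_lift, Category.comp_id, Category.id_comp]

end Fix

/-! ### Calculus of derivatives along vector fields -/

section FieldDerivatives

variable {C : Type u} [Category.{v} C] [CartesianMonoidalCategory C] [CartesianLeftAdditive C]
  [CartesianDifferential C]

/-- The derivative of `g` along the vector field `ξ`. -/
def fieldDeriv {S B : C} (ξ : S ⟶ S) (g : S ⟶ B) : S ⟶ B :=
  lift (𝟙 S) ξ ≫ D g

variable {S : C} (ξ : S ⟶ S)

theorem fieldDeriv_add {B : C} (g h : S ⟶ B) :
    fieldDeriv ξ (g + h) = fieldDeriv ξ g + fieldDeriv ξ h := by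
  rw [fieldDeriv, D_add, comp_add]; rfl

@[simp]
theorem fieldDeriv_zero {B : C} : fieldDeriv ξ (0 : S ⟶ B) = 0 := by
  rw [fieldDeriv, D_zero, comp_zero]

/-- The `n`-th derivative along `ξ` at `e`, as a homomorphism of monoids. -/
def jet {Γ : C} (e : Γ ⟶ S) (n : ℕ) (B : C) : (S ⟶ B) →+ (Γ ⟶ B) where
  toFun g := e ≫ (fieldDeriv ξ)^[n] g
  map_zero' := by
    rw [Function.iterate_fixed (fieldDeriv_zero ξ), comp_zero]
  map_add' g h := by
    rw [← comp_add]
    congr 1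
    induction n with
    | zero => rfl
    | succ n ih => simp only [Function.iterate_succ_apply', ih, fieldDeriv_add]

theorem jet_apply {Γ B : C} (e : Γ ⟶ S) (n : ℕ) (g : S ⟶ B) :
    jet ξ e n B g = e ≫ (fieldDeriv ξ)^[n] g := rfl

theorem jet_zero_apply {Γ B : C} (e : Γ ⟶ S) (g : S ⟶ B) : jet ξ e 0 B g = e ≫ g := rfl

theorem jet_succ {Γ B : C} (e : Γ ⟶ S) (n : ℕ) (g : S ⟶ B) :
    jet ξ e (n + 1) B g = jet ξ e n B (fieldDeriv ξ g) := rfl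

theorem fieldDeriv_iterate_nsmul {B : C} (n m : ℕ) (g : S ⟶ B) :
    (fieldDeriv ξ)^[n] (m • g) = m • (fieldDeriv ξ)^[n] g := by
  simpa only [jet_apply, Category.id_comp] using map_nsmul (jet ξ (𝟙 S) n B) m g

theorem fieldDeriv_comp {W B : C} (u : S ⟶ W) (h : W ⟶ B) :
    fieldDeriv ξ (u ≫ h) = lift u (fieldDeriv ξ u) ≫ D h := by
  rw [fieldDeriv, D_comp, ← Category.assoc, comp_lift, lift_fst_assoc, Category.id_comp]; rfl

theorem fieldDeriv_lift {W W' : C} (u : S ⟶ W) (w : S ⟶ W') :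
    fieldDeriv ξ (lift u w) = lift (fieldDeriv ξ u) (fieldDeriv ξ w) := by
  rw [fieldDeriv, D_lift, comp_lift]; rfl

theorem fieldDeriv_comp_fst {W W' : C} (u : S ⟶ W ⊗ W') :
    fieldDeriv ξ (u ≫ fst W W') = fieldDeriv ξ u ≫ fst W W' := by
  rw [fieldDeriv_comp, D_fst, lift_snd_assoc]

theorem fieldDeriv_comp_snd {W W' : C} (u : S ⟶ W ⊗ W') :
    fieldDeriv ξ (u ≫ snd W W') = fieldDeriv ξ u ≫ snd W W' := by
  rw [fieldDeriv_comp, D_snd, lift_snd_assoc]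

theorem fieldDeriv_id : fieldDeriv ξ (𝟙 S) = ξ := by
  rw [fieldDeriv, D_id, lift_snd]

theorem fieldDeriv_fst {A B : C} (ξ : A ⊗ B ⟶ A ⊗ B) :
    fieldDeriv ξ (fst A B) = ξ ≫ fst A B := by
  rw [fieldDeriv, D_fst, lift_snd_assoc]

theorem fieldDeriv_snd {A B : C} (ξ : A ⊗ B ⟶ A ⊗ B) :
    fieldDeriv ξ (snd A B) = ξ ≫ snd A B := by
  rw [fieldDeriv, D_snd, lift_snd_assoc]

theorem fieldDeriv_iterate_lift {W W' : C} (n : ℕ) (u : S ⟶ W) (w : S ⟶ W') :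
    (fieldDeriv ξ)^[n] (lift u w) = lift ((fieldDeriv ξ)^[n] u) ((fieldDeriv ξ)^[n] w) := by
  induction n with
  | zero => rfl
  | succ n ih => simp only [Function.iterate_succ_apply', ih, fieldDeriv_lift]

theorem jet_lift {Γ W W' : C} (e : Γ ⟶ S) (n : ℕ) (u : S ⟶ W) (w : S ⟶ W') :
    jet ξ e n _ (lift u w) = lift (jet ξ e n _ u) (jet ξ e n _ w) := by
  simp only [jet_apply, fieldDeriv_iterate_lift, comp_lift]

/-- Chain rule for `φ`-related vector fields. -/
theorem comp_fieldDeriv {S' : C} {ξ' : S' ⟶ S'} {ξ : S ⟶ S} {φ : S' ⟶ S}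
    (h : fieldDeriv ξ' φ = φ ≫ ξ) {B : C} (g : S ⟶ B) :
    φ ≫ fieldDeriv ξ g = fieldDeriv ξ' (φ ≫ g) := by
  rw [fieldDeriv_comp, h, fieldDeriv, ← Category.assoc, comp_lift, Category.comp_id]

theorem comp_fieldDeriv_iterate {S' : C} {ξ' : S' ⟶ S'} {ξ : S ⟶ S} {φ : S' ⟶ S}
    (h : fieldDeriv ξ' φ = φ ≫ ξ) {B : C} (n : ℕ) (g : S ⟶ B) :
    φ ≫ (fieldDeriv ξ)^[n] g = (fieldDeriv ξ')^[n] (φ ≫ g) := by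
  induction n with
  | zero => rfl
  | succ n ih => simp only [Function.iterate_succ_apply', comp_fieldDeriv h, ih]

/-- The second derivative of `g` at `x` in the directions `p` and `q`. -/
def secondDeriv {Γ W B : C} (g : W ⟶ B) (x p q : Γ ⟶ W) : Γ ⟶ B :=
  lift (lift x p) (lift q 0) ≫ D (D g)

theorem secondDeriv_symm {Γ W B : C} (g : W ⟶ B) (x p q : Γ ⟶ W) :
    secondDeriv g x p q = secondDeriv g x q p :=
  D_D_symm g x p q

theorem secondDeriv_zero_right {Γ W B : C} (g : W ⟶ B) (x p : Γ ⟶ W) :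
    secondDeriv g x p 0 = 0 := by
  rw [secondDeriv, lift_zero_zero, lift_zero_D]

theorem secondDeriv_zero_left {Γ W B : C} (g : W ⟶ B) (x p : Γ ⟶ W) :
    secondDeriv g x 0 p = 0 := by
  rw [secondDeriv_symm, secondDeriv_zero_right]

theorem comp_secondDeriv {Δ Γ W B : C} (e : Δ ⟶ Γ) (g : W ⟶ B) (x p q : Γ ⟶ W) :
    e ≫ secondDeriv g x p q = secondDeriv g (e ≫ x) (e ≫ p) (e ≫ q) := by
  simp only [secondDeriv, ← Category.assoc, comp_lift, comp_zero]

theorem fieldDeriv_fieldDeriv {B : C} (ξ η : S ⟶ S) (g : S ⟶ B) :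
    fieldDeriv ξ (fieldDeriv η g) =
      secondDeriv g (𝟙 S) η ξ + fieldDeriv (fieldDeriv ξ η) g := by
  have h : lift ξ (fieldDeriv ξ η) = lift ξ 0 + lift 0 (fieldDeriv ξ η) := by
    rw [lift_add_lift, zero_add, add_zero]
  rw [fieldDeriv.eq_1 η g, fieldDeriv_comp, fieldDeriv_lift, fieldDeriv_id, h, lift_add_D,
    D_D_linear]
  rfl

/-- The Lie bracket identity, arranged without subtraction; the second-order terms agree by
symmetry. -/
theorem fieldDeriv_comm {B : C} (ξ η : S ⟶ S) (g : S ⟶ B) :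
    fieldDeriv ξ (fieldDeriv η g) + fieldDeriv (fieldDeriv η ξ) g =
      fieldDeriv η (fieldDeriv ξ g) + fieldDeriv (fieldDeriv ξ η) g := by
  rw [fieldDeriv_fieldDeriv, fieldDeriv_fieldDeriv, secondDeriv_symm]
  abel

theorem lift_D_congr {V W W' B Γ : C} {m : V ⟶ W} {h : W ⟶ B} {m' : V ⟶ W'} {h' : W' ⟶ B}
    (H : m ≫ h = m' ≫ h') (x y : Γ ⟶ V) :
    lift (x ≫ m) (lift x y ≫ D m) ≫ D h = lift (x ≫ m') (lift x y ≫ D m') ≫ D h' := by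
  have := congrArg (fun k => lift x y ≫ D k) H
  simpa only [D_comp, ← Category.assoc, comp_lift, lift_fst] using this

/-- The axiom `D_D_linear` at generic arguments, differentiated in the base point in direction `q`.
-/
theorem D_D_D_linear {Γ W B : C} (g : W ⟶ B) (x p q r : Γ ⟶ W) :
    lift (lift (lift x p) (lift 0 r)) (lift (lift q 0) 0) ≫ D (D (D g)) =
      secondDeriv g x r q := by
  have H := lift_D_congr (D_D_linear g (fst (W ⊗ W) W ≫ fst W W) (fst (W ⊗ W) W ≫ snd W W)
    (snd (W ⊗ W) W)) (lift (lift x p) r) (lift (lift q 0) 0)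
  simpa only [D_lift, D_comp, D_fst, D_snd, D_zero, comp_lift, comp_zero, lift_fst, lift_snd,
    lift_fst_assoc, lift_snd_assoc, Category.assoc, lift_zero_zero, secondDeriv] using H

theorem D_D_D_symm {Γ W B : C} (g : W ⟶ B) (x p q r : Γ ⟶ W) :
    lift (lift (lift x p) (lift r 0)) (lift (lift q 0) 0) ≫ D (D (D g)) =
      lift (lift (lift x r) (lift p 0)) (lift (lift q 0) 0) ≫ D (D (D g)) := by
  have H := lift_D_congr (D_D_symm g (fst (W ⊗ W) W ≫ fst W W) (fst (W ⊗ W) W ≫ snd W W)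
    (snd (W ⊗ W) W)) (lift (lift x p) r) (lift (lift q 0) 0)
  simpa only [D_lift, D_comp, D_fst, D_snd, D_zero, comp_lift, comp_zero, lift_fst, lift_snd,
    lift_fst_assoc, lift_snd_assoc, Category.assoc, lift_zero_zero] using H

/-- Leibniz rule. The third-order term is again written as a second derivative, of `D g`, so that
inductions can stay within this form. -/
theorem fieldDeriv_secondDeriv {W B : C} (g : W ⟶ B) (x p q : S ⟶ W) :
    fieldDeriv ξ (secondDeriv g x p q) =
      secondDeriv (D g) (lift x (fieldDeriv ξ x)) (lift p 0) (lift q 0) +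
        secondDeriv g x (fieldDeriv ξ p) q + secondDeriv g x p (fieldDeriv ξ q) := by
  have h : lift (lift (fieldDeriv ξ x) (fieldDeriv ξ p)) (lift (fieldDeriv ξ q) (0 : S ⟶ W)) =
      lift (lift (fieldDeriv ξ x) 0) 0 + lift (lift 0 (fieldDeriv ξ p)) 0 +
        lift 0 (lift (fieldDeriv ξ q) 0) := by
    simp only [lift_add_lift, zero_add, add_zero]
  rw [secondDeriv, fieldDeriv_comp, fieldDeriv_lift, fieldDeriv_lift, fieldDeriv_lift,
    fieldDeriv_zero, h, lift_add_D, lift_add_D]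
  congr 1
  · congr 1
    · rw [D_D_symm, D_D_D_symm]; rfl
    · rw [D_D_symm, D_D_D_linear]
  · rw [D_D_linear]; rfl

/-- A bilinear expression in `p`, `q` vanishing to orders `k`, `l` vanishes to order `k + l`: each
derivative lowers one order by at most one. The induction quantifies over `W` and `g` because the
Leibniz rule passes to `D g` on `W ⊗ W`. -/
theorem jet_secondDeriv_eq_zero {Γ : C} (e : Γ ⟶ S) (n : ℕ) :
    ∀ {W B : C} (k l : ℕ) (g : W ⟶ B) (x p q : S ⟶ W),
      (∀ i < k, jet ξ e i W p = 0) → (∀ i < l, jet ξ e i W q = 0) → n < k + l →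
        jet ξ e n B (secondDeriv g x p q) = 0 := by
  induction n with
  | zero =>
    intro W B k l g x p q hp hq hn
    rw [jet_zero_apply, comp_secondDeriv]
    rcases Nat.eq_zero_or_pos k with rfl | hk
    · have := hq 0 (by omega)
      rw [jet_zero_apply] at this
      rw [this, secondDeriv_zero_right]
    · have := hp 0 hk
      rw [jet_zero_apply] at this
      rw [this, secondDeriv_zero_left]
  | succ n ih =>
    intro W B k l g x p q hp hq hn
    have hl : ∀ (m : ℕ) (r : S ⟶ W), (∀ i < m, jet ξ e i W r = 0) →
        ∀ i < m, jet ξ e i (W ⊗ W) (lift r 0) = 0 := by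
      intro m r hr i hi
      rw [jet_lift, hr i hi, map_zero, lift_zero_zero]
    have hs : ∀ (m : ℕ) (r : S ⟶ W), (∀ i < m, jet ξ e i W r = 0) →
        ∀ i < m - 1, jet ξ e i W (fieldDeriv ξ r) = 0 := by
      intro m r hr i hi
      exact hr (i + 1) (by omega)
    rw [jet_succ, fieldDeriv_secondDeriv, map_add, map_add,
      ih k l _ _ _ _ (hl k p hp) (hl l q hq) (by omega),
      ih (k - 1) l _ _ _ _ (hs k p hp) hq (by omega),
      ih k (l - 1) _ _ _ _ hp (hs l q hq) (by omega), add_zero, add_zero]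

/-- Heisenberg relations: `[β, α] = γ` commutes with `α`. Moving `β` rightwards past each `α` leaves
one `γ`, and `β` kills `G`. -/
theorem fieldDeriv_fieldDeriv_iterate {B : C} {α β γ : S ⟶ S} (hαβ : fieldDeriv α β = 0)
    (hβα : fieldDeriv β α = γ) (hαγ : fieldDeriv α γ = 0) (hγα : fieldDeriv γ α = 0)
    {G : S ⟶ B} (hG : fieldDeriv β G = 0) (n : ℕ) :
    fieldDeriv β ((fieldDeriv α)^[n] G) =
      n • (fieldDeriv α)^[n - 1] (fieldDeriv γ G) := by
  have h0 (g : S ⟶ B) : fieldDeriv 0 g = 0 := lift_zero_D g _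
  have hc (g : S ⟶ B) : fieldDeriv γ (fieldDeriv α g) = fieldDeriv α (fieldDeriv γ g) := by
    have := fieldDeriv_comm γ α g
    rwa [hαγ, hγα, h0, add_zero, add_zero] at this
  have hγ (n : ℕ) (g : S ⟶ B) :
      fieldDeriv γ ((fieldDeriv α)^[n] g) = (fieldDeriv α)^[n] (fieldDeriv γ g) :=
    (Function.Commute.iterate_right (f := fieldDeriv γ) hc n) g
  induction n with
  | zero => simpa using hG
  | succ n ih =>
    have := fieldDeriv_comm β α ((fieldDeriv α)^[n] G)
    rw [hαβ, hβα, h0, add_zero, ih, hγ] at this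
    rw [Function.iterate_succ_apply', this, Nat.add_sub_cancel, succ_nsmul]
    congr 1
    -- At `n = 0` the truncated exponent `n - 1` is harmless, its coefficient being `0`.
    rcases n with _ | n
    · simp
    · have h1 := fieldDeriv_iterate_nsmul α 1 (n + 1)
        ((fieldDeriv α)^[n] (fieldDeriv γ G))
      rw [Function.iterate_one] at h1
      rw [Nat.add_sub_cancel, h1, Function.iterate_succ_apply']

theorem fieldDeriv_iterate_fieldDeriv_iterate {B : C} {α β γ : S ⟶ S}
    (hαβ : fieldDeriv α β = 0) (hβα : fieldDeriv β α = γ) (hαγ : fieldDeriv α γ = 0)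
    (hγα : fieldDeriv γ α = 0) (hβγ : fieldDeriv β γ = 0) (hγβ : fieldDeriv γ β = 0)
    {G : S ⟶ B} (hG : fieldDeriv β G = 0) (n j : ℕ) :
    (fieldDeriv β)^[j] ((fieldDeriv α)^[n] G) =
      n.descFactorial j • (fieldDeriv α)^[n - j] ((fieldDeriv γ)^[j] G) := by
  have h0 (g : S ⟶ B) : fieldDeriv 0 g = 0 := lift_zero_D g _
  have hβ (j : ℕ) : fieldDeriv β ((fieldDeriv γ)^[j] G) = 0 := by
    induction j with
    | zero => exact hG
    | succ j ih =>
      have := fieldDeriv_comm β γ ((fieldDeriv γ)^[j] G)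
      rwa [hγβ, hβγ, h0, add_zero, add_zero, ih, fieldDeriv_zero,
        ← Function.iterate_succ_apply' (fieldDeriv γ)] at this
  induction j with
  | zero => simp
  | succ j ih =>
    have h1 := fieldDeriv_iterate_nsmul β 1 (n.descFactorial j)
      ((fieldDeriv α)^[n - j] ((fieldDeriv γ)^[j] G))
    rw [Function.iterate_one] at h1
    rw [Function.iterate_succ_apply', ih, h1,
      fieldDeriv_fieldDeriv_iterate hαβ hβα hαγ hγα (hβ j), Nat.descFactorial_succ,
      smul_smul, mul_comm, Nat.sub_sub, Function.iterate_succ_apply' (fieldDeriv γ)]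

end FieldDerivatives

/-! ### Monotonicity of jets under composition -/

section Jets

variable {C : Type u} [Category.{v} C] [CartesianMonoidalCategory C] [CartesianLeftAdditive C]
  [CartesianDifferential C] [OmegaCpoEnriched C]

/-- By the chain rule the derivative of `u ≫ h` is `(u, ξu) ≫ D h`, to which the induction
hypothesis applies. -/
theorem jet_comp_le_jet_comp {S Γ : C} (ξ : S ⟶ S) (e : Γ ⟶ S) (n : ℕ) :
    ∀ {W B : C} {u u' : S ⟶ W} (h : W ⟶ B), (∀ i ≤ n, jet ξ e i W u ≤ jet ξ e i W u') →
      jet ξ e n B (u ≫ h) ≤ jet ξ e n B (u' ≫ h) := by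
  induction n with
  | zero =>
    intro W B u u' h hu
    have := hu 0 le_rfl
    simp only [jet_zero_apply] at this ⊢
    rw [← Category.assoc, ← Category.assoc]
    exact comp_le_comp this le_rfl
  | succ n ih =>
    intro W B u u' h hu
    rw [jet_succ, jet_succ, fieldDeriv_comp, fieldDeriv_comp]
    refine ih _ fun i hi => ?_
    rw [jet_lift, jet_lift]
    exact lift_le_lift (hu i (by omega)) (hu (i + 1) (by omega))

end Jets

/-! ### Taylor monomials as jets -/

section TaylorMonomials

variable {C : Type u} [Category.{v} C] [CartesianMonoidalCategory C] [CartesianLeftAdditive C]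
  [CartesianDifferential C]

/-- The vector field `(a, b) ↦ (b, 0)` on `A × A`. -/
def shiftField (A : C) : A ⊗ A ⟶ A ⊗ A :=
  lift (snd A A) 0

theorem fieldDeriv_shiftField_fst (A : C) :
    fieldDeriv (shiftField A) (fst A A) = snd A A := by
  rw [fieldDeriv_fst, shiftField, lift_fst]

theorem fieldDeriv_shiftField_snd (A : C) :
    fieldDeriv (shiftField A) (snd A A) = 0 := by
  rw [fieldDeriv_snd, shiftField, lift_snd]

theorem fieldDeriv_shiftField_self (A : C) :
    fieldDeriv (shiftField A) (shiftField A) = 0 := by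
  rw [shiftField.eq_1, fieldDeriv_lift, ← shiftField.eq_1, fieldDeriv_shiftField_snd,
    fieldDeriv_zero, lift_zero_zero]

theorem comp_diagTuple {Δ Γ A : C} (g : Δ ⟶ Γ) (a b : Γ ⟶ A) (n : ℕ) :
    g ≫ diagTuple a b n = diagTuple (g ≫ a) (g ≫ b) n := by
  induction n with
  | zero => rfl
  | succ n ih => exact (comp_lift _ _ _).trans (by rw [ih]; rfl)

theorem fieldDeriv_diagTuple {S A : C} (ξ : S ⟶ S) (a b : S ⟶ A) (n : ℕ) :
    fieldDeriv ξ (diagTuple a b n) = diagTuple (fieldDeriv ξ a) (fieldDeriv ξ b) n := by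
  induction n with
  | zero => rfl
  | succ n ih => exact (fieldDeriv_lift _ _ _).trans (by rw [ih]; rfl)

/-- Repeated differentiation in a constant direction `b` is iteration of the field `b ∂/∂a`. -/
theorem diagTuple_comp_iterD {Γ A B : C} (f : A ⟶ B) (a b : Γ ⟶ A) (n : ℕ) :
    diagTuple a b n ≫ iterD f n =
      lift a b ≫ (fieldDeriv (shiftField A))^[n] (fst A A ≫ f) := by
  have h (n : ℕ) : diagTuple (fst A A) (snd A A) n ≫ iterD f n =
      (fieldDeriv (shiftField A))^[n] (fst A A ≫ f) := by
    induction n with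
    | zero => rfl
    | succ n ih =>
      rw [Function.iterate_succ_apply', ← ih, fieldDeriv_comp, fieldDeriv_diagTuple,
        fieldDeriv_shiftField_fst, fieldDeriv_shiftField_snd]
      have h1 : lift (diagTuple (fst A A) (snd A A) n) (snd A A) ≫
          (powObj A n ◁ diagTuple (𝟙 A) 0 n) ≫ D (iterD f n) =
          lift (diagTuple (fst A A) (snd A A) n) (diagTuple (snd A A) 0 n) ≫ D (iterD f n) := by
        rw [← Category.assoc, lift_whiskerLeft, comp_diagTuple, Category.comp_id, comp_zero]
      exact h1
  rw [← h, ← Category.assoc, comp_diagTuple, lift_fst, lift_snd]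

/-- The `n`-th Taylor monomial as a homomorphism of monoids. -/
def taylorHom (n : ℕ) (A B : C) : (A ⟶ B) →+ (A ⟶ B) :=
  (jet (shiftField A) (lift 0 (𝟙 A)) n B).comp (precompHom (fst A A) B)

theorem taylorHom_apply {A B : C} (n : ℕ) (f : A ⟶ B) :
    taylorHom n A B f = jet (shiftField A) (lift 0 (𝟙 A)) n B (fst A A ≫ f) := rfl

theorem taylorMonomial_eq {A B : C} (n : ℕ) (f : A ⟶ B) :
    taylorMonomial n f = taylorHom n A B f :=
  diagTuple_comp_iterD f 0 (𝟙 A) n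

theorem taylorHom_lift {A W W' : C} (n : ℕ) (u : A ⟶ W) (w : A ⟶ W') :
    taylorHom n A _ (lift u w) = lift (taylorHom n A _ u) (taylorHom n A _ w) := by
  simp only [taylorHom_apply, comp_lift, jet_lift]

/-- The `n`-th monomial is homogeneous of degree `n`. Without subtraction or scalars, this is read
off from the Heisenberg relations on triples `((a, b), c)`. -/
theorem taylorHom_taylorHom {A B : C} (j n : ℕ) (g : A ⟶ B) :
    taylorHom j A B (taylorHom n A B g) = if j = n then n.factorial • taylorHom n A B g else 0 := by
  let S := (A ⊗ A) ⊗ A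
  let b : S ⟶ A := fst (A ⊗ A) A ≫ snd A A
  let c : S ⟶ A := snd (A ⊗ A) A
  -- `α = b ∂/∂a` forms the inner monomial, `β = c ∂/∂b` the outer one, and `γ = c ∂/∂a` is their
  -- bracket.
  let α : S ⟶ S := lift (lift b 0) 0
  let β : S ⟶ S := lift (lift 0 c) 0
  let γ : S ⟶ S := lift (lift c 0) 0
  have hb (ξ : S ⟶ S) : fieldDeriv ξ b = (ξ ≫ fst (A ⊗ A) A) ≫ snd A A := by
    rw [fieldDeriv_comp_snd, fieldDeriv_fst]
  have hc (ξ : S ⟶ S) : fieldDeriv ξ c = ξ ≫ snd (A ⊗ A) A := fieldDeriv_snd ξ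
  have hαβ : fieldDeriv α β = 0 := by
    simp only [β, fieldDeriv_lift, fieldDeriv_zero, hc, α, lift_snd, lift_zero_zero]
  have hγβ : fieldDeriv γ β = 0 := by
    simp only [β, fieldDeriv_lift, fieldDeriv_zero, hc, γ, lift_snd, lift_zero_zero]
  have hαγ : fieldDeriv α γ = 0 := by
    simp only [γ, fieldDeriv_lift, fieldDeriv_zero, hc, α, lift_snd, lift_zero_zero]
  have hβγ : fieldDeriv β γ = 0 := by
    simp only [γ, fieldDeriv_lift, fieldDeriv_zero, hc, β, lift_snd, lift_zero_zero]
  have hγα : fieldDeriv γ α = 0 := by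
    simp only [α, fieldDeriv_lift, fieldDeriv_zero, hb, γ, lift_fst, lift_snd, lift_zero_zero]
  have hβα : fieldDeriv β α = γ := by
    simp only [α, γ, fieldDeriv_lift, fieldDeriv_zero, hb, β, lift_fst, lift_snd]
  let G : S ⟶ B := fst (A ⊗ A) A ≫ fst A A ≫ g
  have hG : fieldDeriv β G = 0 := by
    have h1 : fieldDeriv β (fst (A ⊗ A) A ≫ fst A A) = 0 := by
      rw [fieldDeriv_comp_fst, fieldDeriv_fst]
      simp only [β, lift_fst]
    simp only [G]
    rw [← Category.assoc, fieldDeriv_comp, h1, lift_zero_D]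
  let ι : A ⊗ A ⟶ S := lift (lift 0 (fst A A)) (snd A A)
  have hι : fieldDeriv (shiftField A) ι = ι ≫ β := by
    simp only [ι, β, fieldDeriv_lift, fieldDeriv_zero, fieldDeriv_shiftField_fst,
      fieldDeriv_shiftField_snd, comp_lift, comp_zero, c, lift_snd]
  have hfst : fieldDeriv α (fst (A ⊗ A) A) = fst (A ⊗ A) A ≫ shiftField A := by
    rw [fieldDeriv_fst, shiftField, comp_lift, comp_zero]
    simp only [α, b, lift_fst]
  let κ : A ⊗ A ⟶ S := lift (lift (fst A A) 0) (snd A A)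
  have hκ : fieldDeriv (shiftField A) κ = κ ≫ γ := by
    simp only [κ, γ, fieldDeriv_lift, fieldDeriv_zero, fieldDeriv_shiftField_fst,
      fieldDeriv_shiftField_snd, comp_lift, comp_zero, c, lift_snd]
  have h1 : fst A A ≫ taylorHom n A B g = ι ≫ (fieldDeriv α)^[n] G := by
    rw [taylorHom_apply, jet_apply, ← comp_fieldDeriv_iterate hfst]
    simp only [← Category.assoc]
    congr 1
    simp only [ι, comp_lift, lift_fst, comp_zero, Category.comp_id]
  let e : A ⟶ S := lift (lift 0 0) (𝟙 A)
  have h2 : lift 0 (𝟙 A) ≫ ι = e := by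
    simp only [ι, e, comp_lift, comp_zero, lift_fst, lift_snd]
  have h3 : lift 0 (𝟙 A) ≫ κ = e := by
    simp only [κ, e, comp_lift, comp_zero, lift_fst, lift_snd]
  have h4 (j : ℕ) : e ≫ (fieldDeriv γ)^[j] G = taylorHom j A B g := by
    rw [← h3, Category.assoc, comp_fieldDeriv_iterate hκ, taylorHom_apply, jet_apply]
    congr 2
    simp only [G, κ, lift_fst_assoc]
  -- At `e` the coordinate `b` is zero, so `α` vanishes there and only terms without `α` survive.
  have h5 (F : S ⟶ B) : e ≫ fieldDeriv α F = 0 := by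
    have : e ≫ α = 0 := by
      simp only [e, α, b, comp_lift, lift_fst_assoc, comp_zero, lift_zero_zero,
        CartesianLeftAdditive.zero_snd]
    rw [fieldDeriv, ← Category.assoc, comp_lift, this, lift_zero_D]
  rw [taylorHom_apply, jet_apply, h1, ← comp_fieldDeriv_iterate hι, ← Category.assoc, h2,
    fieldDeriv_iterate_fieldDeriv_iterate hαβ hβα hαγ hγα hβγ hγβ hG]
  have h6 (m : ℕ) (F : S ⟶ B) : e ≫ (m • F) = m • (e ≫ F) := map_nsmul (precompHom e B) m F
  rw [h6]
  rcases lt_trichotomy j n with h | rfl | h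
  · obtain ⟨m, hm⟩ : ∃ m, n - j = m + 1 := ⟨n - j - 1, by omega⟩
    rw [hm, Function.iterate_succ_apply', h5, smul_zero, if_neg h.ne]
  · rw [if_pos rfl, Nat.sub_self, Nat.descFactorial_self, Function.iterate_zero, id, h4]
  · rw [Nat.descFactorial_eq_zero_iff_lt.2 h, zero_smul, if_neg h.ne']

theorem taylorHom_secondDeriv_eq_zero {A W B : C} {n k l : ℕ} (g : W ⟶ B) (x p q : A ⟶ W)
    (hp : ∀ i < k, taylorHom i A W p = 0) (hq : ∀ i < l, taylorHom i A W q = 0)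
    (hn : n < k + l) : taylorHom n A B (secondDeriv g x p q) = 0 := by
  rw [taylorHom_apply, comp_secondDeriv]
  exact jet_secondDeriv_eq_zero _ _ n k l g _ _ _ hp hq hn

/-- The shift field has zero derivative along itself, so two outer derivatives form a pure second
derivative. Terms of order at least two are thus quadratic in `b`. -/
theorem diagTuple_comp_iterD_add_two {Γ A B : C} (f : A ⟶ B) (a b : Γ ⟶ A) (n : ℕ) :
    diagTuple a b (n + 2) ≫ iterD f (n + 2) =
      secondDeriv ((fieldDeriv (shiftField A))^[n] (fst A A ≫ f)) (lift a b) (lift b 0)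
        (lift b 0) := by
  have h : lift a b ≫ shiftField A = lift b 0 := by
    rw [shiftField, comp_lift, lift_snd, comp_zero]
  rw [diagTuple_comp_iterD, Function.iterate_succ_apply', Function.iterate_succ_apply',
    fieldDeriv_fieldDeriv, fieldDeriv_shiftField_self, comp_add, comp_secondDeriv,
    Category.comp_id, h, fieldDeriv, lift_zero_D, comp_zero, add_zero]

end TaylorMonomials

/-! ### Continuity of differentiation and comparison of Taylor monomials -/

section Continuity

variable {C : Type u} [Category.{v} C] [CartesianMonoidalCategory C] [MonoidalClosed C]
  [CartesianLeftAdditive C] [CartesianDifferential C] [CartesianClosedDifferential C]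
  [OmegaCpoEnriched C]

theorem preservesSup_lift {Γ A B : C} (k : Γ ⟶ B) :
    PreservesSup fun x : Γ ⟶ A => lift x k := by
  intro c s _ hs
  constructor
  · rintro _ ⟨n, rfl⟩
    exact lift_le_lift (hs.1 ⟨n, rfl⟩) le_rfl
  · intro g hg
    have h1 : s ≤ g ≫ fst A B := hs.2 (by
      rintro _ ⟨n, rfl⟩
      simpa using comp_le_comp (hg ⟨n, rfl⟩) (le_refl (fst A B)))
    have h2 : k ≤ g ≫ snd A B := by
      simpa using comp_le_comp (hg ⟨0, rfl⟩) (le_refl (snd A B))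
    have := lift_le_lift h1 h2
    rwa [← comp_lift, lift_fst_snd, Category.comp_id] at this

/-- Write `f` as evaluation at the constant `lam f` and differentiate. As `f` then enters only
through `lam`, continuity of `D` follows. -/
theorem D_eq_lam {A B : C} (f : A ⟶ B) :
    D f = lift (lift (toUnit (A ⊗ A) ≫ lam (snd (𝟙_ C) A ≫ f)) (fst A A)) (lift 0 (snd A A)) ≫
      D (evalMap A B) := by
  have h : f = lift (toUnit A ≫ lam (snd (𝟙_ C) A ≫ f)) (𝟙 A) ≫ evalMap A B := by
    rw [lift_lam_evalMap, lift_snd_assoc, Category.id_comp]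
  have h0 : D (toUnit A) = 0 := toUnit_unique _ _
  conv_lhs => rw [h]
  rw [D_comp, D_lift, D_comp, D_id, h0, lift_zero_D, comp_lift, Category.comp_id]
  congr 3
  rw [← Category.assoc]
  congr 1
  exact toUnit_unique _ _

theorem preservesSup_D {A B : C} : PreservesSup fun f : A ⟶ B => D f := by
  intro c s hc hs
  simp only [fun n => D_eq_lam (c n)]
  rw [D_eq_lam s]
  have h1 : Monotone fun n => snd (𝟙_ C) A ≫ c n := fun i j h => comp_le_comp le_rfl (hc h)
  have h2 := (monotone_of_additive (fun k : 𝟙_ C ⊗ A ⟶ B => lam k) lam_add).comp h1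
  have h3 : Monotone fun n => toUnit (A ⊗ A) ≫ lam (snd (𝟙_ C) A ≫ c n) :=
    fun i j h => comp_le_comp le_rfl (h2 h)
  have h4 : Monotone fun n => lift (toUnit (A ⊗ A) ≫ lam (snd (𝟙_ C) A ≫ c n)) (fst A A) :=
    fun i j h => lift_le_lift (h3 h) le_rfl
  have h5 : Monotone fun n =>
      lift (lift (toUnit (A ⊗ A) ≫ lam (snd (𝟙_ C) A ≫ c n)) (fst A A))
        (lift (0 : A ⊗ A ⟶ (ihom A).obj B) (snd A A)) :=
    fun i j h => lift_le_lift (h4 h) le_rfl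
  exact preservesSup_postcomp _ _ _ h5 (preservesSup_lift _ _ _ h4 (preservesSup_lift _ _ _ h3
    (preservesSup_precomp _ _ _ h2 (preservesSup_lam _ _ h1
      (preservesSup_precomp _ _ _ hc hs)))))

theorem preservesSup_fieldDeriv {S B : C} (ξ : S ⟶ S) :
    PreservesSup fun g : S ⟶ B => fieldDeriv ξ g :=
  (preservesSup_precomp _).comp preservesSup_D (monotone_of_additive _ D_add)

theorem preservesSup_taylorHom (n : ℕ) (A B : C) : PreservesSup (taylorHom n A B) := by
  have h (n : ℕ) : PreservesSup fun g : A ⊗ A ⟶ B => (fieldDeriv (shiftField A))^[n] g := by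
    induction n with
    | zero => exact fun _ _ _ hs => hs
    | succ n ih =>
      exact ih.comp (preservesSup_fieldDeriv _) (monotone_of_additive _ (fieldDeriv_add _))
  intro c s hc hs
  have h1 : Monotone fun m => fst A A ≫ c m := fun i j h => comp_le_comp le_rfl (hc h)
  have h2 : Monotone fun g : A ⊗ A ⟶ B => (fieldDeriv (shiftField A))^[n] g :=
    monotone_of_additive _ fun f g => by
      simpa only [jet_apply, Category.id_comp] using
        map_add (jet (shiftField A) (𝟙 _) n B) f g
  exact preservesSup_precomp _ _ _ (h2.comp h1) (h n _ _ h1 (preservesSup_precomp _ _ _ hc hs))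

theorem taylorHom_mono (n : ℕ) (A B : C) : Monotone (taylorHom n A B) :=
  monotone_of_additive _ (map_add _)

variable [TaylorCategory C]

theorem smul_hom_mono {A B : C} (r : ℚ≥0) : Monotone fun f : A ⟶ B => r • f :=
  monotone_of_additive _ (smul_add r)

theorem monotone_sum_range {A B : C} (v : ℕ → (A ⟶ B)) :
    Monotone fun N => ∑ n ∈ Finset.range N, v n :=
  fun _ _ h => Finset.sum_le_sum_of_subset (Finset.range_mono h)

theorem isLUB_taylorHom {A B : C} (f : A ⟶ B) :
    IsLUB (Set.range fun N : ℕ => ∑ n ∈ Finset.range N,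
      ((n.factorial : ℚ≥0)⁻¹) • taylorHom n A B f) f := by
  have := TaylorCategory.taylor f 0 (𝟙 A)
  rw [zero_add, Category.id_comp] at this
  simpa only [← taylorMonomial_eq, taylorMonomial] using this

theorem le_of_taylorHom_le {A B : C} {f g : A ⟶ B}
    (h : ∀ n, taylorHom n A B f ≤ taylorHom n A B g) : f ≤ g := by
  refine (isLUB_taylorHom f).2 ?_
  rintro _ ⟨N, rfl⟩
  exact (Finset.sum_le_sum fun n _ => smul_hom_mono _ (h n)).trans
    ((isLUB_taylorHom g).1 ⟨N, rfl⟩)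

/-- Take `v = ∑ (1/n!) taylorHom n (w n)`; in degree `j` only the `j`-th term contributes, and its
`j!` cancels. -/
theorem exists_taylorHom_eq {A B : C} (w : ℕ → (A ⟶ B)) :
    ∃ v : A ⟶ B, ∀ n, taylorHom n A B v = taylorHom n A B (w n) := by
  have hm := monotone_sum_range fun n => ((n.factorial : ℚ≥0)⁻¹) • taylorHom n A B (w n)
  refine ⟨ωSup ⟨_, hm⟩, fun j => ?_⟩
  refine (preservesSup_taylorHom j A B _ _ hm (isLUB_range_ωSup ⟨_, hm⟩)).unique ?_
  have h (N : ℕ) : taylorHom j A B (∑ n ∈ Finset.range N,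
      ((n.factorial : ℚ≥0)⁻¹) • taylorHom n A B (w n)) =
        if j < N then taylorHom j A B (w j) else 0 := by
    have h1 (n : ℕ) : ((n.factorial : ℚ≥0)⁻¹) • taylorHom j A B (taylorHom n A B (w n)) =
        if j = n then taylorHom j A B (w j) else 0 := by
      rw [taylorHom_taylorHom]
      split_ifs with hjn
      · subst hjn
        rw [← Nat.cast_smul_eq_nsmul ℚ≥0, smul_smul,
          inv_mul_cancel₀ (Nat.cast_ne_zero.2 j.factorial_ne_zero), one_smul]
      · rw [smul_zero]
    simp only [map_sum, map_nnrat_smul, h1, Finset.sum_ite_eq, Finset.mem_range]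
  simp only [h]
  refine IsGreatest.isLUB ⟨⟨j + 1, if_pos j.lt_succ_self⟩, ?_⟩
  rintro _ ⟨N, rfl⟩
  dsimp only
  split_ifs
  · exact le_rfl
  · exact zero_le

/-- Replace the degree-`j` part of `y ⊖ z` by that of `s` to get `v`. Degreewise comparison gives `y
≤ z + v`, so `y ⊖ z ≤ v`; now look in degree `j`. -/
theorem taylorHom_tsub_le [TruncatedSubtraction C] {A B : C} {y z s : A ⟶ B} {j : ℕ}
    (h : taylorHom j A B y ≤ taylorHom j A B (z + s)) :
    taylorHom j A B (tsub y z) ≤ taylorHom j A B s := by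
  obtain ⟨v, hv⟩ := exists_taylorHom_eq fun i => if i = j then s else tsub y z
  have hle : y ≤ z + v := le_of_taylorHom_le fun i => by
    rw [map_add, hv, ← map_add]
    split_ifs with hij
    · rwa [hij]
    · exact taylorHom_mono _ _ _ ((tsub_le_iff _ _ _).1 le_rfl)
  refine (taylorHom_mono j A B ((tsub_le_iff _ _ _).2 hle)).trans_eq ?_
  rw [hv, if_pos rfl]

theorem taylorHom_comp_add_le {A W B : C} (f : W ⟶ B) (a b : A ⟶ W) {k n : ℕ}
    (hb : ∀ i < k, taylorHom i A W b = 0) (hn : n < k + k) :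
    taylorHom n A B ((a + b) ≫ f) ≤ taylorHom n A B (a ≫ f + lift a b ≫ D f) := by
  have hb' : ∀ i < k, taylorHom i A (W ⊗ W) (lift b 0) = 0 := fun i hi => by
    rw [taylorHom_lift, hb i hi, map_zero, lift_zero_zero]
  have hm := monotone_sum_range fun n =>
    ((n.factorial : ℚ≥0)⁻¹) • (diagTuple a b n ≫ iterD f n)
  refine (preservesSup_taylorHom n A B _ _ hm (TaylorCategory.taylor f a b)).2 ?_
  rintro _ ⟨N, rfl⟩
  -- Two further terms guarantee that the constant and linear ones can be split off.
  refine (taylorHom_mono n A B (hm (Nat.le_add_right N 2))).trans_eq ?_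
  dsimp only
  have h0 : ∑ i ∈ Finset.range N, (((i + 1 + 1).factorial : ℚ≥0)⁻¹) •
      taylorHom n A B (diagTuple a b (i + 1 + 1) ≫ iterD f (i + 1 + 1)) = 0 :=
    Finset.sum_eq_zero fun i _ => by
      rw [diagTuple_comp_iterD_add_two, taylorHom_secondDeriv_eq_zero _ _ _ _ hb' hb' hn,
        smul_zero]
  rw [Finset.sum_range_succ', Finset.sum_range_succ', map_add, map_add, map_sum]
  simp only [map_nnrat_smul]
  rw [h0, zero_add, add_comm, ← map_nnrat_smul, ← map_nnrat_smul, ← map_add]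
  simp only [Nat.factorial, mul_one, Nat.cast_one, inv_one, one_smul]
  have h1 : diagTuple a b 1 ≫ iterD f 1 = lift a b ≫ D f := by
    have h : lift a b ≫ (W ◁ 𝟙 W) ≫ D f = lift a b ≫ D f := by
      rw [whiskerLeft_id, Category.id_comp]
    exact h
  rw [h1]
  rfl

theorem taylorHom_lift_partialDAt_le {A X B : C} (f : A ⊗ X ⟶ B) (z : A ⟶ X) {u u' : A ⟶ X}
    {n : ℕ} (h : ∀ i ≤ n, taylorHom i A X u ≤ taylorHom i A X u') :
    taylorHom n A B (lift (𝟙 A) u ≫ partialDAt f z) ≤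
      taylorHom n A B (lift (𝟙 A) u' ≫ partialDAt f z) := by
  rw [taylorHom_apply, taylorHom_apply, ← Category.assoc, ← Category.assoc]
  refine jet_comp_le_jet_comp _ _ n _ fun i hi => ?_
  rw [comp_lift, comp_lift, jet_lift, jet_lift]
  exact lift_le_lift le_rfl (h i hi)

end Continuity

/-! ### Quadratic convergence -/

section Quadratic

variable {C : Type u} [Category.{v} C] [CartesianMonoidalCategory C] [MonoidalClosed C]
  [CartesianLeftAdditive C] [CartesianDifferential C] [CartesianClosedDifferential C]
  [CartesianDifferentialFixpoint C] [OmegaCpoEnriched C] [TruncatedSubtraction C]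
  [TaylorCategory C] [KleeneFixpoint C]

theorem taylorHom_newton_correction {A X : C} {f : A ⊗ X ⟶ X} (hf : NilpotentPartial f)
    {z d : A ⟶ X} (hd : z + d = lift (𝟙 A) z ≫ f) (hz : z ≤ fix f) {k : ℕ}
    (hk : ∀ i < k, taylorHom i A X z = taylorHom i A X (fix f)) {n : ℕ} (hn : n < k + k) :
    taylorHom n A X (z + lift (𝟙 A) d ≫ repStar (partialDAt f z)) =
      taylorHom n A X (fix f) := by
  apply le_antisymm (taylorHom_mono n A X (newton_correction_le_fix f hd hz))
  set w := lift (𝟙 A) d ≫ repStar (partialDAt f z) with hw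
  set u := tsub (fix f) z with hu
  have hzu : z + u = fix f := add_tsub_of_le hz
  have hwd : w = d + lift (𝟙 A) w ≫ partialDAt f z := by
    rw [hw, lift_repStar, ← lift_starBody, lift_fix]
  -- Compare with `s = 0` in `taylorHom_tsub_le`.
  have hu0 (i : ℕ) (hi : i < k) : taylorHom i A X u = 0 := by
    refine le_antisymm ?_ zero_le
    rw [← map_zero (taylorHom i A X)]
    exact taylorHom_tsub_le (by rw [add_zero, hk i hi])
  have hu1 (i : ℕ) (hi : i < k + k) :
      taylorHom i A X u ≤ taylorHom i A X (d + lift (𝟙 A) u ≫ partialDAt f z) := by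
    refine taylorHom_tsub_le ?_
    have h := taylorHom_comp_add_le f (lift (𝟙 A) z) (lift 0 u) (k := k) (n := i)
      (fun j hj => by rw [taylorHom_lift, hu0 j hj, map_zero, lift_zero_zero]) hi
    rw [← Category.id_comp z, ← lift_partialDAt, Category.id_comp, lift_add_lift, add_zero,
      hzu, lift_fix] at h
    rwa [← add_assoc, hd]
  -- Substituting the bound into itself: additivity of `D_z f` and `w = d + D_z f · w` absorb `d`
  -- into `w`.
  have hup (p : ℕ) : ∀ i < k + k, taylorHom i A X u ≤
      taylorHom i A X (w + lift (𝟙 A) u ≫ iterSnd (partialDAt f z) p) := by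
    induction p with
    | zero =>
      intro i _
      rw [iterSnd, lift_snd]
      exact taylorHom_mono i A X le_add_self
    | succ p ih =>
      intro i hi
      refine (hu1 i hi).trans ?_
      have h := taylorHom_lift_partialDAt_le f z (n := i) fun j hj => ih j (by omega)
      rw [map_add]
      refine (add_le_add_right h _).trans_eq ?_
      rw [← map_add, lift_add_partialDAt, ← add_assoc, ← hwd, lift_iterSnd_succ]
  obtain ⟨p, hp⟩ := exists_iterSnd_partialDAt_eq_zero hf z
  have h := hup p n hn
  rw [hp, comp_zero, add_zero] at h
  rw [← hzu, map_add, map_add]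
  exact add_le_add_right h _

theorem taylorDist_le_sq {A B : C} {z z' y : A ⟶ B}
    (h : ∀ k, (∀ i < k, taylorMonomial i z = taylorMonomial i y) →
      ∀ i < k + k, taylorMonomial i z' = taylorMonomial i y) :
    taylorDist z' y ≤ taylorDist z y ^ 2 := by
  classical
  by_cases h1 : ∃ n, taylorMonomial n z' ≠ taylorMonomial n y
  · have h2 : ∃ n, taylorMonomial n z ≠ taylorMonomial n y := by
      by_contra! h2
      obtain ⟨n, hn⟩ := h1
      -- Agreement below `n + 1` forces agreement below `2(n + 1)`, which exceeds `n`.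
      exact hn (h (n + 1) (fun i _ => h2 i) n (by omega))
    have h3 := h (Nat.find h2) fun i hi => not_not.1 (Nat.find_min h2 hi)
    have h4 : Nat.find h2 * 2 ≤ Nat.find h1 := by
      rw [Nat.le_find_iff]
      exact fun m hm => not_not.2 (h3 m (by omega))
    rw [taylorDist, taylorDist, dif_pos h1, dif_pos h2, ← pow_mul]
    exact pow_le_pow_of_le_one (by norm_num) (by norm_num) h4
  · rw [taylorDist, dif_neg h1]
    positivity

theorem taylorDist_newton_correction {A X : C} {f : A ⊗ X ⟶ X} (hf : NilpotentPartial f)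
    {z d : A ⟶ X} (hd : z + d = lift (𝟙 A) z ≫ f) (hz : z ≤ fix f) :
    taylorDist (z + lift (𝟙 A) d ≫ repStar (partialDAt f z)) (fix f) ≤
      taylorDist z (fix f) ^ 2 := by
  refine taylorDist_le_sq fun k hk i hi => ?_
  simp only [taylorMonomial_eq] at hk ⊢
  exact taylorHom_newton_correction hf hd hz hk hi

end Quadratic

end NewtonFix

theorem mainTheorem3 {C : Type u} [Category.{v} C] [CartesianMonoidalCategory C]
    [MonoidalClosed C] [NewtonFix.CartesianLeftAdditive C] [NewtonFix.CartesianDifferential C]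
    [NewtonFix.CartesianClosedDifferential C] [NewtonFix.CartesianDifferentialFixpoint C]
    [NewtonFix.OmegaCpoEnriched C] [NewtonFix.TruncatedSubtraction C]
    [NewtonFix.TaylorCategory C] [NewtonFix.KleeneFixpoint C] :
    -- convergence from below to the least fixpoint, for the combinators
    (∀ X : C,
      Monotone (NewtonFix.newtonComb X) ∧
      (∀ n : ℕ, NewtonFix.newtonComb X n ≤ NewtonFix.fixComb X) ∧
      IsLUB (Set.range (NewtonFix.newtonComb X)) (NewtonFix.fixComb X)) ∧
    -- the same for the approximants of each map with parameters
    (∀ (A X : C) (f : A ⊗ X ⟶ X),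
      Monotone (NewtonFix.newton f) ∧
      (∀ n : ℕ, NewtonFix.newton f n ≤ NewtonFix.CartesianDifferentialFixpoint.fix f) ∧
      IsLUB (Set.range (NewtonFix.newton f)) (NewtonFix.CartesianDifferentialFixpoint.fix f)) ∧
    -- quadratic convergence, for the approximants of `f` and for the combinators applied to `f`
    (∀ (A X : C) (f : A ⊗ X ⟶ X),
      lift (0 : 𝟙_ C ⟶ A) (0 : 𝟙_ C ⟶ X) ≫ f = 0 →
      NewtonFix.NilpotentPartial f →
      ∀ n : ℕ,
        NewtonFix.taylorDist (NewtonFix.newton f (n + 1))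
            (NewtonFix.CartesianDifferentialFixpoint.fix f) ≤
          NewtonFix.taylorDist (NewtonFix.newton f n)
            (NewtonFix.CartesianDifferentialFixpoint.fix f) ^ 2 ∧
        NewtonFix.taylorDist (NewtonFix.lam f ≫ NewtonFix.newtonComb X (n + 1))
            (NewtonFix.lam f ≫ NewtonFix.fixComb X) ≤
          NewtonFix.taylorDist (NewtonFix.lam f ≫ NewtonFix.newtonComb X n)
            (NewtonFix.lam f ≫ NewtonFix.fixComb X) ^ 2) := by
  refine ⟨fun X => ⟨NewtonFix.newton_monotone _, NewtonFix.newton_le_fix _,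
      NewtonFix.isLUB_newton _⟩, fun A X f => ⟨NewtonFix.newton_monotone f,
      NewtonFix.newton_le_fix f, NewtonFix.isLUB_newton f⟩, fun A X f _ hf n => ⟨?_, ?_⟩⟩
  · exact NewtonFix.taylorDist_newton_correction hf
      (NewtonFix.add_tsub_of_le (NewtonFix.newton_le_apply f n)) (NewtonFix.newton_le_fix f n)
  · rw [NewtonFix.lam_newtonComb_succ, NewtonFix.lam_fixComb]
    refine NewtonFix.taylorDist_newton_correction hf (NewtonFix.lam_newtonComb_add_tsub f n) ?_
    rw [← NewtonFix.lam_fixComb f]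
    exact NewtonFix.comp_le_comp le_rfl (NewtonFix.newton_le_fix _ n)
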